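/- Let $N$ be a finite set and let $Y=(Y_i)_{i\in N}$ be a real random vector with a regular joint Gaussian distribution, that is, a Gaussian distribution whose covariance matrix is invertible. For pairwise disjoint subsets $a,b,c\subseteq N$ write $a\perp b\mid c$ if the subvectors $Y_a$ and $Y_b$ are conditionally independent given $Y_c$ (with $c=\emptyset$ meaning independence). Let $G$ be a simple undirected graph on the node set $N$, regarded either as a concentration graph or as a covariance graph, and suppose that $G$ is a forest, i.e. a disjoint union of trees. For nodes $i\ne k$ put $c_{ik}=N\setminus\{i,k\}$ if $G$ is regarded as a concentration graph and $c_{ik}=\emptyset$ if $G$ is regarded as a covariance graph. Assume that $G$ represents both (1) an independence structure of $Y$: $i\perp k\mid c_{ik}$ for every pair of distinct nodes $i,k$ that is not coupled by an edge of $G$; and (2) a dependence structure of $Y$: $i\perp k\mid c_{ik}$ fails for every pair of nodes $i,k$ that is coupled by an edge of $G$. Then the distribution of $Y$ is faithful to $G$: for all pairwise disjoint $a,b,c\subseteq N$, the independence $a\perp b\mid c$ holds if and only if it is implied by $G$. Here a concentration graph $G$ implies $a\perp b\mid c$ if every path in $G$ from a node of $a$ to a node of $b$ has an inner node in $c$,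 and a covariance graph $G$ implies $a\perp b\mid c$ if every path in $G$ from a node of $a$ to a node of $b$ has an inner node in $N\setminus(a\cup b\cup c)$. -/

import Mathlib

open MeasureTheory ProbabilityTheory

namespace GraphicalGaussian

/-- The subvector `x_a` of `x`, for a set `a` of coordinates. -/
def subvector {ι : Type*} (a : Set ι) (x : ι → ℝ) : a → ℝ := fun j => x j

theorem measurable_subvector {ι : Type*} (a : Set ι) : Measurable (subvector a) :=
  measurable_pi_lambda _ fun j => measurable_pi_apply j.1

/-- `a ⊥ b | c` under `μ`: if `Y` has distribution `μ`, then the subvectors `Y_a` and `Y_b` are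
conditionally independent given (the σ-algebra generated by) `Y_c`. -/
def CondIndepGiven {ι : Type*} [Finite ι] (μ : Measure (ι → ℝ)) [IsFiniteMeasure μ]
    (a b c : Set ι) : Prop :=
  CondIndepFun (MeasurableSpace.comap (subvector c) inferInstance)
    (measurable_subvector c).comap_le (subvector a) (subvector b) μ

/-- The covariance matrix of a distribution on `ι → ℝ`. -/
noncomputable def covMatrix {ι : Type*} (μ : Measure (ι → ℝ)) : Matrix ι ι ℝ :=
  Matrix.of fun i j => cov[fun x => x i, fun x => x j; μ]

/-- The two types of undirected graph: a concentration graph (all its edges are full lines) and a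
covariance graph (all its edges are dashed lines). -/
inductive EdgeType
  | concentration
  | covariance

/-- The conditioning set in the (in)dependence statement attached to the pair `i`, `k`: all other
nodes in a concentration graph, no node in a covariance graph. -/
def EdgeType.pairCond {ι : Type*} (e : EdgeType) (i k : ι) : Set ι :=
  match e with
  | .concentration => {i, k}ᶜ
  | .covariance => ∅

/-- The graph represents an independence structure of `μ`: for every missing edge the
corresponding pairwise independence holds. -/
def RepresentsIndependence {ι : Type*} [Finite ι] (e : EdgeType) (G : SimpleGraph ι)
    (μ : Measure (ι → ℝ)) [IsFiniteMeasure μ] : Prop :=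
  ∀ i k, i ≠ k → ¬ G.Adj i k → CondIndepGiven μ {i} {k} (e.pairCond i k)

/-- The graph represents a dependence structure of `μ`: for every edge present the corresponding
pairwise dependence does not vanish. -/
def RepresentsDependence {ι : Type*} [Finite ι] (e : EdgeType) (G : SimpleGraph ι)
    (μ : Measure (ι → ℝ)) [IsFiniteMeasure μ] : Prop :=
  ∀ i k, G.Adj i k → ¬ CondIndepGiven μ {i} {k} (e.pairCond i k)

/-- A path intersects `s` if it has an inner node in `s`. -/
def Intersects {ι : Type*} {G : SimpleGraph ι} {i k : ι} (p : G.Path i k) (s : Set ι) : Prop :=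
  ∃ j ∈ p.1.support, j ≠ i ∧ j ≠ k ∧ j ∈ s

/-- The set that all paths from `a` to `b` have to intersect for `a ⊥ b | c` to be implied: the
conditioning set `c` in a concentration graph, and in a covariance graph the set of remaining
nodes, over which one marginalises. -/
def EdgeType.blockingSet {ι : Type*} (e : EdgeType) (a b c : Set ι) : Set ι :=
  match e with
  | .concentration => c
  | .covariance => (a ∪ b ∪ c)ᶜ

/-- The graph implies `a ⊥ b | c` (global Markov property). -/
def GraphImplies {ι : Type*} (e : EdgeType) (G : SimpleGraph ι) (a b c : Set ι) : Prop :=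
  ∀ i ∈ a, ∀ k ∈ b, ∀ p : G.Path i k, Intersects p (e.blockingSet a b c)

/-- `μ` is faithful to the graph: for disjoint `a`, `b`, `c`, the independence `a ⊥ b | c` holds
under `μ` exactly when it is implied by the graph. -/
def Faithful {ι : Type*} [Finite ι] (e : EdgeType) (G : SimpleGraph ι)
    (μ : Measure (ι → ℝ)) [IsFiniteMeasure μ] : Prop :=
  ∀ a b c : Set ι, Disjoint a b → Disjoint a c → Disjoint b c →
    (CondIndepGiven μ a b c ↔ GraphImplies e G a b c)

end GraphicalGaussian

/-!
# Faithfulness of regular Gaussian distributions to forests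

Let `S` be the covariance matrix of the Gaussian vector `Y`. For a node `k` and a set `c`, let `r`
be the coefficient vector of the residual of `Y_k` after linear regression on `Y_c`
(`IsResidual`). The entry `(S r)_i` is the partial covariance of `Y_i` and `Y_k` given `Y_c`, and
`a ⊥ b | c` holds if and only if these entries vanish for all `i ∈ a` and `k ∈ b`
(`condIndepGiven_iff`). Applied to the pairwise statements attached to the edges, this says that
the forest `G` is the off-diagonal support of `S⁻¹` for a concentration graph, and of `S` for a
covariance graph.

It remains to decide when `(S r)_i = 0`. Both cases come down to one question about a positive
definite matrix `A` supported by a forest: if `x` lives on a set `D` of nodes, `A x` vanishes on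
`D` except at `k`, and `x_k ≠ 0`, where in `D` does `x` vanish? Exactly at the nodes not joined to
`k` inside `D`. On a component of `D` without `k` the quadratic form of `A` at `x` is zero, so `x`
is zero there (`eq_zero_of_not_joinedIn`). Along a path to `k` every edge is a bridge, and the
same argument on the part cut off by a bridge shows that a zero of `x` on one side of it forces
one on the other (`ne_zero_of_isPath`): in a forest there is no second path whose contribution
could cancel the first.

For a concentration graph take `A = S⁻¹`, `x = S r` and `D = cᶜ`. For a covariance graph take
`A = S`, `x = r` and `D = c ∪ {i, k}`: if `(S r)_i` were zero although `i` and `k` are joined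
inside `D`, then `r_i ≠ 0` would follow, but `r_i = 0` by definition of a residual; if they are
not joined, `r` vanishes on the component of `i`, and so does row `i` of `S r`. The graph side is
then a matter of comparing paths that avoid the blocking set with walks inside `D`.
-/

namespace GraphicalGaussian

open Matrix

/-! ### Walks inside a set of nodes -/

section Walks

variable {ι : Type*} {G : SimpleGraph ι}

/-- `i` and `k` are joined by a walk of `G` inside `D`. -/
def JoinedIn (G : SimpleGraph ι) (D : Set ι) (i k : ι) : Prop :=
  ∃ p : G.Walk i k, ∀ u ∈ p.support, u ∈ D

theorem JoinedIn.exists_isPath {D : Set ι} {i k : ι} (h : JoinedIn G D i k) :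
    ∃ p : G.Walk i k, p.IsPath ∧ ∀ u ∈ p.support, u ∈ D := by
  classical
  obtain ⟨p, hp⟩ := h
  exact ⟨p.bypass, p.bypass_isPath, fun u hu => hp u (p.support_bypass_subset_support hu)⟩

theorem JoinedIn.mem_right {D : Set ι} {i k : ι} (h : JoinedIn G D i k) : k ∈ D := by
  obtain ⟨p, hp⟩ := h
  exact hp k p.end_mem_support

theorem JoinedIn.trans_adj {D : Set ι} {i u v : ι} (h : JoinedIn G D i u) (huv : G.Adj u v)
    (hv : v ∈ D) : JoinedIn G D i v := by
  obtain ⟨p, hp⟩ := h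
  refine ⟨p.concat huv, fun w hw => ?_⟩
  rw [SimpleGraph.Walk.support_concat, List.mem_append] at hw
  rcases hw with hw | hw
  · exact hp w hw
  · rw [List.mem_singleton.1 hw]; exact hv

end Walks

/-! ### Positive definite matrices with forest support -/

section LinearAlgebra

variable {ι : Type*} [Fintype ι]

/-- The hypothesis makes the quadratic form of `A` vanish at the restriction of `x` to `B`, which is
therefore zero. -/
theorem eq_zero_of_mul_mulVec_indicator_eq_zero {A : Matrix ι ι ℝ} (hA : A.PosDef) {B : Set ι}
    {x : ι → ℝ} (h : ∀ u ∈ B, x u * (A *ᵥ B.indicator x) u = 0) {u : ι} (hu : u ∈ B) :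
    x u = 0 := by
  by_contra hxu
  have hne : B.indicator x ≠ 0 := fun h0 => hxu <| by
    simpa [hu] using congrFun h0 u
  have hpos := hA.dotProduct_mulVec_pos hne
  refine hpos.ne' (Finset.sum_eq_zero fun v _ => ?_)
  by_cases hv : v ∈ B
  · simpa [hv] using h v hv
  · simp [hv]

theorem mulVec_indicator_apply {A : Matrix ι ι ℝ} {B : Set ι} {x : ι → ℝ} {u : ι}
    (h : ∀ v, v ∉ B → A u v * x v = 0) : (A *ᵥ B.indicator x) u = (A *ᵥ x) u := by
  refine Finset.sum_congr rfl fun v _ => ?_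
  by_cases hv : v ∈ B
  · simp [hv]
  · simp [hv, h v hv]

/-- The off-diagonal support of the matrix `A` is the adjacency relation of `G`. -/
def IsSupportedBy (A : Matrix ι ι ℝ) (G : SimpleGraph ι) : Prop :=
  ∀ u v, u ≠ v → (A u v ≠ 0 ↔ G.Adj u v)

variable {G : SimpleGraph ι}

/-- The step that uses acyclicity. If `A x` vanishes on `D` off `k`, `x` is supported in `D` and
`x k ≠ 0`, then `x` has no zero on a path inside `D` that ends at `k`. The proof walks along the path from
`k`: if `v` follows `w` and `x w ≠ 0`, the edge `s(v, w)` is a bridge, so the rows of `A` in the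
component of `v` after its deletion do not see the rest of `x`, except for the entry
`A v w * x w`. If `x v` vanished, the quadratic form of `A` would vanish on that component, hence
so would `x`, and row `v` would read `A v w * x w = 0`. -/
theorem ne_zero_of_isPath {A : Matrix ι ι ℝ} (hA : A.PosDef)
    (hAG : IsSupportedBy A G) (hG : G.IsAcyclic) {D : Set ι} {x : ι → ℝ} {k : ι}
    (hD : ∀ u, u ∉ D → x u = 0) (hAx : ∀ u ∈ D, u ≠ k → (A *ᵥ x) u = 0) (hk : x k ≠ 0)
    {i : ι} (p : G.Walk i k) (hp : p.IsPath) (hpD : ∀ u ∈ p.support, u ∈ D) : x i ≠ 0 := by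
  induction p with
  | nil => exact hk
  | @cons v w k hvw p ih =>
    rw [SimpleGraph.Walk.cons_isPath_iff] at hp
    simp only [SimpleGraph.Walk.support_cons, List.mem_cons, forall_eq_or_imp] at hpD
    have hw : x w ≠ 0 := ih hAx hk hp.1 hpD.2
    intro hv
    -- Deleting the edge from `v` to `w` separates `v` from `w`, and hence from `k`.
    have hbr := (SimpleGraph.isAcyclic_iff_forall_adj_isBridge.1 hG) hvw
    rw [SimpleGraph.isBridge_iff] at hbr
    set H := G.deleteEdges {s(v, w)} with hH
    have hvk : v ≠ k := fun h => hp.2 (h ▸ p.end_mem_support)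
    have hkB : ¬ H.Reachable v k := by
      intro h
      refine hbr (h.trans ?_)
      have : s(v, w) ∉ p.edges := fun he => hp.2 (p.fst_mem_support_of_mem_edges he)
      exact ⟨(p.toDeleteEdge _ this).reverse⟩
    let B : Set ι := {u | u ∈ D ∧ H.Reachable v u}
    have hvB : v ∈ B := ⟨hpD.1, .rfl⟩
    have hwB : w ∉ B := fun h => hbr h.2
    -- The only edge of `G` that leaves `B` inside `D` is the one from `v` to `w`.
    have hout : ∀ u ∈ B, ∀ u', u' ∉ B → (u = v → u' ≠ w) → A u u' * x u' = 0 := by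
      intro u hu u' hu' hne
      by_cases hu'D : u' ∈ D
      · have huu' : u ≠ u' := fun h => hu' (h ▸ hu)
        have hnadj : ¬ G.Adj u u' := by
          intro hadj
          refine hu' ⟨hu'D, hu.2.trans (SimpleGraph.Adj.reachable ?_)⟩
          rw [hH, SimpleGraph.deleteEdges_adj]
          refine ⟨hadj, ?_⟩
          simp only [Set.mem_singleton_iff, Sym2.eq_iff, not_or, not_and]
          exact ⟨hne, fun h _ => hwB (h ▸ hu)⟩
        rw [not_not.1 (mt (hAG u u' huu').1 hnadj), zero_mul]
      · rw [hD u' hu'D, mul_zero]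
    have hB : ∀ u ∈ B, x u = 0 := by
      intro u hu
      refine eq_zero_of_mul_mulVec_indicator_eq_zero hA (fun u hu => ?_) hu
      by_cases huv : u = v
      · rw [huv, hv, zero_mul]
      · rw [mulVec_indicator_apply fun u' hu' => hout u hu u' hu' fun h => absurd h huv,
          hAx u hu.1 (by rintro rfl; exact hkB hu.2), mul_zero]
    have hAv := hAx v hpD.1 hvk
    have : (A *ᵥ x) v = A v w * x w := by
      refine Finset.sum_eq_single w (fun u' _ hu' => ?_) (by simp)
      by_cases huB : u' ∈ B
      · rw [hB u' huB, mul_zero]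
      · exact hout v hvB u' huB fun _ => hu'
    exact mul_ne_zero ((hAG v w hvw.ne).2 hvw) hw (this ▸ hAv)

/-- The rows of `A` indexed by a component of `G` inside `D` only see that component. -/
theorem mulVec_indicator_joinedIn {A : Matrix ι ι ℝ} (hAG : IsSupportedBy A G) {D : Set ι}
    {x : ι → ℝ} (hD : ∀ u, u ∉ D → x u = 0) {i u : ι} (hu : JoinedIn G D i u) :
    (A *ᵥ {u | JoinedIn G D i u}.indicator x) u = (A *ᵥ x) u := by
  refine mulVec_indicator_apply fun v hv => ?_
  by_cases hvD : v ∈ D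
  · have huv : u ≠ v := fun h => hv (h ▸ hu)
    rw [not_not.1 (mt (hAG u v huv).1 fun hadj => hv (hu.trans_adj hadj hvD)), zero_mul]
  · rw [hD v hvD, mul_zero]

/-- If `k` is not in the component of `i` inside `D`, then `x` vanishes on that component. Only the
products `x u * (A *ᵥ x) u` are required to vanish, because in a covariance graph `A x` need not
vanish at `i`, whereas `x i` does. -/
theorem eq_zero_of_not_joinedIn {A : Matrix ι ι ℝ} (hA : A.PosDef) (hAG : IsSupportedBy A G)
    {D : Set ι} {x : ι → ℝ} {i k : ι} (hD : ∀ u, u ∉ D → x u = 0)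
    (hAx : ∀ u ∈ D, u ≠ k → x u * (A *ᵥ x) u = 0) (hik : ¬ JoinedIn G D i k)
    {u : ι} (hu : JoinedIn G D i u) : x u = 0 := by
  refine eq_zero_of_mul_mulVec_indicator_eq_zero hA
    (B := {u | JoinedIn G D i u}) (fun u hu => ?_) hu
  rw [mulVec_indicator_joinedIn hAG hD hu]
  exact hAx u hu.mem_right fun h => hik (h ▸ hu)

/-! ### Residuals and partial covariances -/

variable [DecidableEq ι]

/-- `r` is the coefficient vector of the residual of the `k`-th coordinate after linear regression
on the coordinates in `c`, for a random vector with covariance matrix `S`: it differs from the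
`k`-th unit vector only in `c`, and the residual is uncorrelated with the coordinates in `c`. The
`i`-th entry of `S *ᵥ r` is then the partial covariance of the coordinates `i` and `k` given
`c`. -/
structure IsResidual (S : Matrix ι ι ℝ) (c : Set ι) (k : ι) (r : ι → ℝ) : Prop where
  eq_single : ∀ j, j ∉ c → r j = (Pi.single k 1 : ι → ℝ) j
  mulVec_eq_zero : ∀ j ∈ c, (S *ᵥ r) j = 0

/-- The normal equations of the regression on `c` are solvable, because the principal submatrix of
`S` on `c` is positive definite. -/
theorem exists_isResidual {S : Matrix ι ι ℝ} (hS : S.PosDef) (c : Set ι) (k : ι) :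
    ∃ r, IsResidual S c k r := by
  classical
  let T : Matrix c c ℝ := S.submatrix (↑) (↑)
  have hT : T.PosDef := hS.submatrix Subtype.val_injective
  let y : c → ℝ := T⁻¹ *ᵥ fun j => S j k
  have hy : T *ᵥ y = fun j : c => S j k := by
    simp [y, Matrix.mulVec_mulVec,
      Matrix.mul_nonsing_inv _ ((Matrix.isUnit_iff_isUnit_det _).1 hT.isUnit)]
  let z : ι → ℝ := fun j => if h : j ∈ c then y ⟨j, h⟩ else 0
  refine ⟨Pi.single k 1 - z, fun j hj => by simp [z, hj], fun j hj => ?_⟩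
  have h1 : (S *ᵥ z) j = (T *ᵥ y) ⟨j, hj⟩ := by
    exact Finset.sum_congr_set c _ _ (fun j' hj' => by simp [T, z, hj'])
      (fun j' hj' => by simp [z, hj'])
  rw [Matrix.mulVec_sub, Pi.sub_apply, h1, hy]
  simp

/-- The partial variance of a coordinate outside `c` is positive. -/
theorem IsResidual.mulVec_pos {S : Matrix ι ι ℝ} (hS : S.PosDef) {c : Set ι} {k : ι} {r : ι → ℝ}
    (hr : IsResidual S c k r) (hk : k ∉ c) : 0 < (S *ᵥ r) k := by
  have hrk : r k = 1 := by simp [hr.eq_single k hk]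
  have hpos := hS.dotProduct_mulVec_pos (x := r) (fun h => by simp [h] at hrk)
  have : star r ⬝ᵥ S *ᵥ r = (S *ᵥ r) k := by
    rw [dotProduct, Finset.sum_eq_single k]
    · simp [hrk]
    · intro j _ hjk
      by_cases hj : j ∈ c
      · rw [hr.mulVec_eq_zero j hj, mul_zero]
      · simp [hr.eq_single j hj, hjk]
    · simp
  rwa [← this]

/-- For a concentration matrix with forest support, the partial covariance of `i` and `k` given `c`
vanishes exactly when `c` separates `i` from `k`. -/
theorem IsResidual.eq_zero_iff_concentration {S : Matrix ι ι ℝ} (hS : S.PosDef)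
    (hSG : IsSupportedBy S⁻¹ G) (hG : G.IsAcyclic) {c : Set ι} {i k : ι} {r : ι → ℝ}
    (hr : IsResidual S c k r) (hi : i ∉ c) (hk : k ∉ c) :
    (S *ᵥ r) i = 0 ↔ ¬ JoinedIn G cᶜ i k := by
  -- The vector `S r` is supported off `c`, and `S⁻¹ (S r) = r` vanishes off `c` except at `k`.
  have hinv : S⁻¹ *ᵥ (S *ᵥ r) = r := by
    simp [Matrix.mulVec_mulVec,
      Matrix.nonsing_inv_mul _ ((Matrix.isUnit_iff_isUnit_det _).1 hS.isUnit)]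
  have hD : ∀ u, u ∉ cᶜ → (S *ᵥ r) u = 0 := fun u hu => hr.mulVec_eq_zero u (not_not.1 hu)
  have hAx : ∀ u ∈ cᶜ, u ≠ k → (S⁻¹ *ᵥ (S *ᵥ r)) u = 0 := fun u hu huk => by
    rw [hinv, hr.eq_single u hu, Pi.single_eq_of_ne huk]
  constructor
  · intro h hj
    obtain ⟨p, hp, hpD⟩ := hj.exists_isPath
    exact ne_zero_of_isPath hS.inv hSG hG hD hAx (hr.mulVec_pos hS hk).ne' p hp hpD h
  · intro hj
    refine eq_zero_of_not_joinedIn hS.inv hSG hD (fun u hu huk => ?_) hj ⟨.nil, by simpa using hi⟩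
    rw [hAx u hu huk, mul_zero]

/-- For a covariance matrix with forest support, the partial covariance of `i` and `k` given `c`
vanishes exactly when `i` and `k` are not joined inside `c ∪ {i, k}`. -/
theorem IsResidual.eq_zero_iff_covariance {S : Matrix ι ι ℝ} (hS : S.PosDef)
    (hSG : IsSupportedBy S G) (hG : G.IsAcyclic) {c : Set ι} {i k : ι} {r : ι → ℝ}
    (hr : IsResidual S c k r) (hik : i ≠ k) (hi : i ∉ c) (hk : k ∉ c) :
    (S *ᵥ r) i = 0 ↔ ¬ JoinedIn G (c ∪ {i, k}) i k := by
  have hri : r i = 0 := by rw [hr.eq_single i hi, Pi.single_eq_of_ne hik]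
  have hD : ∀ u, u ∉ c ∪ {i, k} → r u = 0 := fun u hu => by
    simp only [Set.mem_union, Set.mem_insert_iff, Set.mem_singleton_iff, not_or] at hu
    rw [hr.eq_single u hu.1, Pi.single_eq_of_ne hu.2.2]
  constructor
  · intro h hj
    obtain ⟨p, hp, hpD⟩ := hj.exists_isPath
    refine ne_zero_of_isPath hS hSG hG hD ?_ (by simp [hr.eq_single k hk]) p hp hpD hri
    rintro u (hu | rfl | rfl) huk
    · exact hr.mulVec_eq_zero u hu
    · exact h
    · exact absurd rfl huk
  · intro hj
    have hii : JoinedIn G (c ∪ {i, k}) i i := ⟨.nil, by simp⟩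
    have hzero : ∀ u, JoinedIn G (c ∪ {i, k}) i u → r u = 0 := by
      refine fun u => eq_zero_of_not_joinedIn hS hSG hD ?_ hj
      rintro u (hu | rfl | rfl) huk
      · rw [hr.mulVec_eq_zero u hu, mul_zero]
      · rw [hri, zero_mul]
      · exact absurd rfl huk
    rw [← mulVec_indicator_joinedIn hSG hD hii, Set.indicator_eq_zero'.2 ?_, mulVec_zero,
      Pi.zero_apply]
    rw [Set.disjoint_left]
    exact fun u hu hu' => hu (hzero u hu')

end LinearAlgebra

/-! ### Conditional independence and measurable shifts -/

section ConditionalIndependence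

theorem condExp_inter_ae_eq_indicator {Ω : Type*} {m' mΩ : MeasurableSpace Ω} {μ : Measure Ω}
    [IsFiniteMeasure μ] {s t : Set Ω} (hs : MeasurableSet s)
    (ht : MeasurableSet[m'] t) : μ⟦s ∩ t | m'⟧ =ᵐ[μ] t.indicator (μ⟦s | m'⟧) := by
  rw [Set.inter_comm, ← Set.indicator_indicator]
  exact condExp_indicator ((integrable_const 1).indicator hs) ht

variable {Ω β β' γ γ' : Type*} {m' mΩ : MeasurableSpace Ω} [StandardBorelSpace Ω]
  [MeasurableSpace β] [MeasurableSpace β'] [MeasurableSpace γ] [MeasurableSpace γ']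
  {hm' : m' ≤ mΩ} {μ : Measure Ω} [IsFiniteMeasure μ]
  {f : Ω → β} {g : Ω → β'} {u : Ω → γ} {v : Ω → γ'}

/-- Conditional independence given `m'` persists when `m'`-measurable functions are adjoined to both
sides. -/
theorem condIndepFun_prodMk_of_measurable (h : CondIndepFun m' hm' f g μ) (hf : Measurable f)
    (hg : Measurable g) (hu : Measurable[m'] u) (hv : Measurable[m'] v) :
    CondIndepFun m' hm' (fun ω => (f ω, u ω)) (fun ω => (g ω, v ω)) μ := by
  have hu' : Measurable u := hu.mono hm' le_rfl
  have hv' : Measurable v := hv.mono hm' le_rfl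
  rw [condIndepFun_iff_condIndep]
  refine CondIndepSets.condIndep (hf.prodMk hu').comap_le (hg.prodMk hv').comap_le
    (isPiSystem_prod.comap _) (isPiSystem_prod.comap _)
    (by rw [← generateFrom_prod, MeasurableSpace.comap_generateFrom]; rfl)
    (by rw [← generateFrom_prod, MeasurableSpace.comap_generateFrom]; rfl) ?_
  rw [condIndepSets_iff]
  rotate_left
  · rintro _ ⟨_, ⟨s, hs, t, ht, rfl⟩, rfl⟩
    exact (hf.prodMk hu') (hs.prod ht)
  · rintro _ ⟨_, ⟨s, hs, t, ht, rfl⟩, rfl⟩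
    exact (hg.prodMk hv') (hs.prod ht)
  rintro _ _ ⟨_, ⟨s, hs, t, ht, rfl⟩, rfl⟩ ⟨_, ⟨s', hs', t', ht', rfl⟩, rfl⟩
  rw [Set.mk_preimage_prod, Set.mk_preimage_prod, Set.inter_inter_inter_comm]
  filter_upwards [condExp_inter_ae_eq_indicator (μ := μ) ((hf hs).inter (hg hs'))
      ((hu ht).inter (hv ht')),
    condExp_inter_ae_eq_indicator (μ := μ) (hf hs) (hu ht),
    condExp_inter_ae_eq_indicator (μ := μ) (hg hs') (hv ht'),
    (condIndepFun_iff_condExp_inter_preimage_eq_mul hf hg).1 h s s' hs hs'] with ω h1 h2 h3 h4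
  rw [Pi.mul_apply, h1, h2, h3]
  by_cases hx : ω ∈ u ⁻¹' t <;> by_cases hy : ω ∈ v ⁻¹' t' <;> simp [hx, hy, h4]

theorem condIndepFun_add_of_measurable [Add β] [Add β'] [MeasurableAdd₂ β] [MeasurableAdd₂ β']
    {u : Ω → β} {v : Ω → β'} (h : CondIndepFun m' hm' f g μ) (hf : Measurable f)
    (hg : Measurable g) (hu : Measurable[m'] u) (hv : Measurable[m'] v) :
    CondIndepFun m' hm' (f + u) (g + v) μ :=
  (condIndepFun_prodMk_of_measurable h hf hg hu hv).comp (φ := fun p : β × β => p.1 + p.2)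
    (ψ := fun p : β' × β' => p.1 + p.2) (by fun_prop) (by fun_prop)

/-- If the pair `(f, g)` is independent of `m'`, all conditional probabilities given `m'` of
events in `f` and `g` are constants. -/
theorem condIndepFun_iff_indepFun_of_indep [IsProbabilityMeasure μ] (hf : Measurable f)
    (hg : Measurable g)
    (h : Indep (MeasurableSpace.comap (fun ω => (f ω, g ω)) inferInstance) m' μ) :
    CondIndepFun m' hm' f g μ ↔ IndepFun f g μ := by
  have hcond : ∀ S : Set (β × β'), MeasurableSet S →
      μ⟦(fun ω => (f ω, g ω)) ⁻¹' S | m'⟧ =ᵐ[μ] fun _ => μ.real ((fun ω => (f ω, g ω)) ⁻¹' S) := by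
    intro S hS
    have := condExp_indep_eq (μ := μ) (hf.prodMk hg).comap_le hm'
      (f := ((fun ω => (f ω, g ω)) ⁻¹' S).indicator fun _ => (1 : ℝ))
      (stronglyMeasurable_const.indicator ⟨S, hS, rfl⟩) h
    rwa [integral_indicator_const _ ((hf.prodMk hg) hS), smul_eq_mul, mul_one] at this
  rw [condIndepFun_iff_condExp_inter_preimage_eq_mul hf hg,
    indepFun_iff_measure_inter_preimage_eq_mul]
  refine forall₄_congr fun s t hs ht => ?_
  have h1 := hcond (s ×ˢ Set.univ) (hs.prod .univ)
  have h2 := hcond (Set.univ ×ˢ t) (MeasurableSet.univ.prod ht)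
  have h3 := hcond (s ×ˢ t) (hs.prod ht)
  simp only [Set.mk_preimage_prod, Set.preimage_univ, Set.inter_univ, Set.univ_inter] at h1 h2 h3
  have key : (μ⟦f ⁻¹' s ∩ g ⁻¹' t | m'⟧ =ᵐ[μ]
      fun ω => (μ⟦f ⁻¹' s | m'⟧) ω * (μ⟦g ⁻¹' t | m'⟧) ω) ↔
      μ.real (f ⁻¹' s ∩ g ⁻¹' t) = μ.real (f ⁻¹' s) * μ.real (g ⁻¹' t) := by
    constructor
    · intro h
      obtain ⟨ω, h, h1, h2, h3⟩ := (h.and (h1.and (h2.and h3))).exists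
      exact h3.symm.trans (h.trans (congrArg₂ _ h1 h2))
    · intro h
      filter_upwards [h1, h2, h3] with ω h1 h2 h3
      rw [h1, h2, h3, h]
  rw [key, Measure.real, Measure.real, Measure.real, ← ENNReal.toReal_mul,
    ENNReal.toReal_eq_toReal_iff' (by finiteness) (by finiteness)]

end ConditionalIndependence

/-! ### Conditional independence of Gaussian subvectors -/

section Gaussian

variable {ι : Type*} [Fintype ι] {μ : Measure (ι → ℝ)} [IsGaussian μ]

theorem hasGaussianLaw_mulVec {κ κ' : Type*} [Fintype κ] [Fintype κ']
    (M : Matrix κ ι ℝ) (M' : Matrix κ' ι ℝ) :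
    HasGaussianLaw (fun x : ι → ℝ => (M *ᵥ x, M' *ᵥ x)) μ :=
  IsGaussian.hasGaussianLaw_id.map_fun
    ((LinearMap.prod M.mulVecLin M'.mulVecLin).toContinuousLinearMap)

theorem memLp_dotProduct (s : ι → ℝ) : MemLp (fun x : ι → ℝ => s ⬝ᵥ x) 2 μ :=
  memLp_finsetSum _ fun j _ =>
    ((IsGaussian.hasGaussianLaw_id (μ := μ)).eval j).memLp_two.const_mul (s j)

theorem covariance_dotProduct (s t : ι → ℝ) :
    cov[fun x => s ⬝ᵥ x, fun x => t ⬝ᵥ x; μ] = s ⬝ᵥ covMatrix μ *ᵥ t := by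
  have hX (i : ι) : MemLp (fun x : ι → ℝ => x i) 2 μ :=
    ((IsGaussian.hasGaussianLaw_id (μ := μ)).eval i).memLp_two
  simp only [dotProduct, mulVec, covMatrix, of_apply]
  rw [covariance_fun_sum_fun_sum (fun i => (hX i).const_mul _) (fun i => (hX i).const_mul _)]
  refine Finset.sum_congr rfl fun i _ => ?_
  rw [Finset.mul_sum]
  refine Finset.sum_congr rfl fun j _ => ?_
  rw [covariance_const_mul_left, covariance_const_mul_right]
  ring

/-- Regularity of the distribution makes the covariance matrix, which is always positive
semidefinite, positive definite. -/
theorem posDef_covMatrix [DecidableEq ι] (h : IsUnit (covMatrix μ)) : (covMatrix μ).PosDef := by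
  refine (PosSemidef.posDef_iff_isUnit (.of_dotProduct_mulVec_nonneg ?_ fun s => ?_)).2 h
  · ext i j
    simp [covMatrix, covariance_comm (fun x : ι → ℝ => x j)]
  · rw [star_trivial, ← covariance_dotProduct, covariance_self (memLp_dotProduct s).aemeasurable]
    exact variance_nonneg _ _

theorem indepFun_mulVec_iff {κ κ' : Type*} [Fintype κ] [Fintype κ']
    (M : Matrix κ ι ℝ) (M' : Matrix κ' ι ℝ) :
    IndepFun (fun x : ι → ℝ => M *ᵥ x) (fun x => M' *ᵥ x) μ ↔
      ∀ i j, M i ⬝ᵥ covMatrix μ *ᵥ M' j = 0 := by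
  simp only [← covariance_dotProduct]
  constructor
  · intro h i j
    exact (h.comp (measurable_pi_apply i) (measurable_pi_apply j)).covariance_eq_zero
      (memLp_dotProduct _) (memLp_dotProduct _)
  · exact (hasGaussianLaw_mulVec M M').indepFun_of_covariance_eval

theorem measurable_dotProduct_comap_subvector {c : Set ι} {s : ι → ℝ} (hs : ∀ j, j ∉ c → s j = 0) :
    Measurable[MeasurableSpace.comap (subvector c) inferInstance] fun x : ι → ℝ => s ⬝ᵥ x := by
  refine Finset.measurable_sum _ fun j _ => ?_
  by_cases hj : j ∈ c
  · exact ((measurable_pi_apply (⟨j, hj⟩ : c)).comp (comap_measurable (subvector c))).const_mul _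
  · simp [hs j hj]

variable [DecidableEq ι]

theorem dotProduct_mulVec_of_isResidual {S : Matrix ι ι ℝ} {c : Set ι} {i k : ι} {s r : ι → ℝ}
    (hs : ∀ j, j ∉ c → s j = (Pi.single i 1 : ι → ℝ) j) (hr : IsResidual S c k r) :
    s ⬝ᵥ S *ᵥ r = (S *ᵥ r) i := by
  rw [← single_one_dotProduct i (S *ᵥ r)]
  refine Finset.sum_congr rfl fun j _ => ?_
  by_cases hj : j ∈ c
  · rw [hr.mulVec_eq_zero j hj, mul_zero, mul_zero]
  · rw [hs j hj]

/-- For a Gaussian vector, `a ⊥ b | c` holds exactly when all partial covariances of a coordinate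
in `a` and one in `b` given `c` vanish. Subtracting the regression on `Y_c`, which is
`Y_c`-measurable, turns `Y_a` and `Y_b` into residual vectors without changing the conditional
independence. The residuals are uncorrelated with, hence independent of, `Y_c`, so that
conditional independence becomes independence, and this in turn means zero correlation. -/
theorem condIndepGiven_iff {a b c : Set ι} {r : ι → ι → ℝ}
    (hr : ∀ k, IsResidual (covMatrix μ) c k (r k)) :
    CondIndepGiven μ a b c ↔ ∀ i ∈ a, ∀ k ∈ b, (covMatrix μ *ᵥ r k) i = 0 := by
  classical
  let M (d : Set ι) : Matrix d ι ℝ := Matrix.of fun i => r i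
  let N (d : Set ι) : Matrix d ι ℝ := Matrix.of fun i => Pi.single (i : ι) 1
  have hM (d : Set ι) : Measurable fun x : ι → ℝ => M d *ᵥ x := by fun_prop
  have hsub (d : Set ι) : (subvector d : (ι → ℝ) → d → ℝ) = fun x => N d *ᵥ x := by
    ext x i
    simp [subvector, N, mulVec]
  have hdiff (d : Set ι) : Measurable[MeasurableSpace.comap (subvector c) inferInstance]
      fun x : ι → ℝ => (N d - M d) *ᵥ x := by
    refine @measurable_pi_lambda _ _ _ (_) _ _ fun i =>
      measurable_dotProduct_comap_subvector fun j hj => ?_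
    simp [N, M, (hr i).eq_single j hj]
  -- Pass between subvectors and residual vectors by adding functions of `Y_c`.
  have hshift : CondIndepGiven μ a b c ↔
      CondIndepFun (MeasurableSpace.comap (subvector c) inferInstance)
        (measurable_subvector c).comap_le (fun x => M a *ᵥ x) (fun x => M b *ᵥ x) μ := by
    constructor
    · intro h
      have := condIndepFun_add_of_measurable h (measurable_subvector a) (measurable_subvector b)
        (hdiff a).neg (hdiff b).neg
      convert this using 1
      · ext x i; simp [hsub, sub_mulVec]
      · ext x i; simp [hsub, sub_mulVec]
    · intro h
      have := condIndepFun_add_of_measurable h (hM a) (hM b) (hdiff a) (hdiff b)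
      rw [CondIndepGiven]
      convert this using 1
      · ext x i; simp [hsub, sub_mulVec]
      · ext x i; simp [hsub, sub_mulVec]
  have hind : Indep (MeasurableSpace.comap (fun x : ι → ℝ => (M a *ᵥ x, M b *ᵥ x)) inferInstance)
      (MeasurableSpace.comap (subvector c) inferInstance) μ := by
    have h := (indepFun_mulVec_iff (μ := μ) (N c) (Matrix.of r)).2 fun j k =>
      (single_one_dotProduct (j : ι) _).trans ((hr k).mulVec_eq_zero j j.2)
    rw [← hsub c] at h
    exact (IndepFun_iff_Indep _ _ _).1 <| h.symm.comp
      (φ := fun y => (subvector a y, subvector b y))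
      ((measurable_subvector a).prodMk (measurable_subvector b)) measurable_id
  rw [hshift, condIndepFun_iff_indepFun_of_indep (hM a) (hM b) hind, indepFun_mulVec_iff]
  have hM_apply (i : a) (k : b) :
      M a i ⬝ᵥ covMatrix μ *ᵥ M b k = (covMatrix μ *ᵥ r k) i :=
    dotProduct_mulVec_of_isResidual (hr i).eq_single (hr k)
  simp only [hM_apply, Subtype.forall]

end Gaussian

/-! ### Separation in the graph -/

section Separation

variable {ι : Type*} {G : SimpleGraph ι} {a b c : Set ι}

theorem graphImplies_concentration_iff (hac : Disjoint a c) (hbc : Disjoint b c) :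
    GraphImplies .concentration G a b c ↔ ∀ i ∈ a, ∀ k ∈ b, ¬ JoinedIn G cᶜ i k := by
  refine forall₄_congr fun i hi k hk => ⟨fun h hj => ?_, fun h p => ?_⟩
  · obtain ⟨p, hp, hpD⟩ := hj.exists_isPath
    obtain ⟨j, hj, -, -, hjc⟩ := h ⟨p, hp⟩
    exact hpD j hj hjc
  · by_contra hp
    refine h ⟨p.1, fun u hu huc => hp ⟨u, hu, ?_, ?_, huc⟩⟩
    · rintro rfl; exact hac.notMem_of_mem_left hi huc
    · rintro rfl; exact hbc.notMem_of_mem_left hk huc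

/-- A walk from `a` to `b` inside `a ∪ b ∪ c` contains a segment from `a` to `b` with inner nodes in
`c`: as long as some other node lies in `a` or `b`, the walk can be shortened. -/
theorem exists_joinedIn_union_pair {i k : ι} (hi : i ∈ a) (hk : k ∈ b) (p : G.Walk i k)
    (hp : ∀ u ∈ p.support, u ∈ a ∪ b ∪ c) :
    ∃ i ∈ a, ∃ k ∈ b, JoinedIn G (c ∪ {i, k}) i k := by
  classical
  induction hn : p.length using Nat.strong_induction_on generalizing i k with
  | _ n ih =>
    subst hn
    by_cases h : ∀ u ∈ p.support, u ∈ c ∪ {i, k}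
    · exact ⟨i, hi, k, hk, p, h⟩
    push Not at h
    obtain ⟨u, hu, hu'⟩ := h
    simp only [Set.mem_union, Set.mem_insert_iff, Set.mem_singleton_iff, not_or] at hu'
    rcases hp u hu with (hua | hub) | huc
    · exact ih _ (SimpleGraph.Walk.length_dropUntil_lt_length hu hu'.2.1) hua hk
        (p.dropUntil u hu)
        (fun w hw => hp w (p.support_dropUntil_subset_support hu hw)) rfl
    · exact ih _ (SimpleGraph.Walk.length_takeUntil_lt_length hu hu'.2.2) hi hub (p.takeUntil u hu)
        (fun w hw => hp w (p.support_takeUntil_subset_support hu hw)) rfl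
    · exact absurd huc hu'.1

/-- The global Markov property of a covariance graph, whose blocking set depends on all of `a` and
`b`, reduces to a condition on the pairs of a node in `a` and a node in `b`. -/
theorem graphImplies_covariance_iff :
    GraphImplies .covariance G a b c ↔ ∀ i ∈ a, ∀ k ∈ b, ¬ JoinedIn G (c ∪ {i, k}) i k := by
  constructor
  · intro h i hi k hk hj
    obtain ⟨p, hp, hpD⟩ := hj.exists_isPath
    obtain ⟨j, hj, hji, hjk, hjc⟩ := h i hi k hk ⟨p, hp⟩
    rcases hpD j hj with hc | rfl | rfl
    · exact hjc (Or.inr hc)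
    · exact hji rfl
    · exact hjk rfl
  · intro h i hi k hk p
    by_contra hp
    obtain ⟨i', hi', k', hk', hj⟩ := exists_joinedIn_union_pair (c := c) hi hk p.1 fun u hu => by
      by_contra huc
      refine hp ⟨u, hu, ?_, ?_, huc⟩
      · rintro rfl; exact huc (Or.inl (Or.inl hi))
      · rintro rfl; exact huc (Or.inl (Or.inr hk))
    exact h i' hi' k' hk' hj

end Separation

/-! ### Edges and matrix entries -/

section Pairwise

variable {ι : Type*} [Fintype ι] [DecidableEq ι] {μ : Measure (ι → ℝ)} [IsGaussian μ]

/-- The dashed edges of a covariance graph correspond to the off-diagonal entries of the covariance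
matrix: with nothing to condition on, the residual of a coordinate is the coordinate itself. -/
theorem condIndepGiven_pair_empty_iff (i k : ι) :
    CondIndepGiven μ {i} {k} ∅ ↔ covMatrix μ i k = 0 := by
  rw [condIndepGiven_iff (r := fun k => Pi.single k 1) fun k => ⟨by simp, by simp⟩]
  simp

/-- The full edges of a concentration graph correspond to the off-diagonal entries of the
concentration matrix `S⁻¹`. -/
theorem condIndepGiven_pair_compl_iff (hS : (covMatrix μ).PosDef) {i k : ι} (hik : i ≠ k) :
    CondIndepGiven μ {i} {k} {i, k}ᶜ ↔ (covMatrix μ)⁻¹ i k = 0 := by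
  choose r hr using exists_isResidual hS {i, k}ᶜ
  rw [condIndepGiven_iff hr]
  simp only [Set.mem_singleton_iff, forall_eq]
  set y := covMatrix μ *ᵥ r k with hy
  have hdet := (Matrix.isUnit_iff_isUnit_det _).1 hS.isUnit
  have hinv : ((covMatrix μ)⁻¹ *ᵥ y) i = 0 := by
    rw [hy, mulVec_mulVec, nonsing_inv_mul _ hdet, one_mulVec, (hr k).eq_single i (by simp),
      Pi.single_eq_of_ne hik]
  -- `y` is supported on `{i, k}`, so row `i` of `S⁻¹ y = r k` relates `y i` to `S⁻¹ i k`.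
  have hsum : ((covMatrix μ)⁻¹ *ᵥ y) i =
      (covMatrix μ)⁻¹ i i * y i + (covMatrix μ)⁻¹ i k * y k := by
    rw [mulVec, dotProduct, Fintype.sum_eq_add i k hik]
    rintro j hj
    rw [show y j = 0 from (hr k).mulVec_eq_zero j (by simpa using hj), mul_zero]
  have hyk : y k ≠ 0 := ((hr k).mulVec_pos hS (by simp)).ne'
  have hii : (covMatrix μ)⁻¹ i i ≠ 0 := hS.inv.diag_pos.ne'
  rw [hsum] at hinv
  constructor <;> intro h <;> simpa [h, hyk, hii] using hinv

end Pairwise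

end GraphicalGaussian

open GraphicalGaussian in
theorem mainTheorem8 {ι : Type*} [Fintype ι] [DecidableEq ι]
    (μ : Measure (ι → ℝ)) [IsGaussian μ] (hreg : IsUnit (GraphicalGaussian.covMatrix μ))
    (e : GraphicalGaussian.EdgeType) (G : SimpleGraph ι) (hforest : G.IsAcyclic)
    (hindep : GraphicalGaussian.RepresentsIndependence e G μ)
    (hdep : GraphicalGaussian.RepresentsDependence e G μ) :
    GraphicalGaussian.Faithful e G μ := by
  intro a b c hab hac hbc
  have hS := posDef_covMatrix hreg
  have hpair : ∀ i k, i ≠ k → (¬ CondIndepGiven μ {i} {k} (e.pairCond i k) ↔ G.Adj i k) :=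
    fun i k hik => ⟨not_imp_comm.1 (hindep i k hik), hdep i k⟩
  choose r hr using exists_isResidual hS c
  rw [condIndepGiven_iff hr]
  cases e with
  | concentration =>
    have hSG : IsSupportedBy (covMatrix μ)⁻¹ G := fun i k hik =>
      (condIndepGiven_pair_compl_iff hS hik).not.symm.trans (hpair i k hik)
    rw [graphImplies_concentration_iff hac hbc]
    exact forall₄_congr fun i hi k hk => (hr k).eq_zero_iff_concentration hS hSG hforest
      (hac.notMem_of_mem_left hi) (hbc.notMem_of_mem_left hk)
  | covariance =>
    have hSG : IsSupportedBy (covMatrix μ) G := fun i k hik =>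
      (condIndepGiven_pair_empty_iff i k).not.symm.trans (hpair i k hik)
    rw [graphImplies_covariance_iff]
    exact forall₄_congr fun i hi k hk => (hr k).eq_zero_iff_covariance hS hSG hforest
      (hab.ne_of_mem hi hk) (hac.notMem_of_mem_left hi) (hbc.notMem_of_mem_left hk)
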